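/- Let $q\ge 1$, $n\ge 1$, $W\ge 0$ be integers, let $p=(p_1,\dots,p_n)$ be integers, and let $\gamma\in\mathbb C$ be a primitive $q$-th root of unity. Put $R(\theta)=\begin{pmatrix}\cos 2\pi\theta&\sin 2\pi\theta\\-\sin 2\pi\theta&\cos 2\pi\theta\end{pmatrix}$, and let $G\subset O(2n)$ and $\tilde G\subset O(2n+W)$ be the cyclic groups generated by $\operatorname{diag}(R(p_1/q),\dots,R(p_n/q))$ and $\operatorname{diag}(R(p_1/q),\dots,R(p_n/q),I_W)$ respectively. (When $\gcd(p_1,\dots,p_n,q)=1$ these groups have order $q$, and $S^{2n-1}/G=L(q:p_1,\dots,p_n)$ and $S^{2n+W-1}/\tilde G$ are the orbifold lens space and the padded orbifold lens space; the coprimality is not needed below.) For a subgroup $\Gamma\subset O(d)$ and $k\ge 0$ let $\mathcal H^k$ be the space of restrictions to the unit sphere $S^{d-1}\subset\mathbb R^d$ of the complex-valued homogeneous harmonic polynomials of degree $k$ on $\mathbb R^d$, let $\mathcal H^k_\Gamma$ be the subspace of its $\Gamma$-invariant functions, and call $\sum_{k\ge 0}(\dim\mathcal H^k_\Gamma)z^k$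 the spectral generating function of $S^{d-1}/\Gamma$. Let $F_q(z:p_1,\dots,p_n)$ and $F_q^{W+}(z:p_1,\dots,p_n,0)$ be the spectral generating functions of $S^{2n-1}/G$ and $S^{2n+W-1}/\tilde G$. Then both series converge absolutely for $|z|<1$, and for all such $z$ $$F_q^{W+}(z:p_1,\dots,p_n,0)=\frac{1+z}{(1-z)^{W-1}}\cdot\frac1q\sum_{l=1}^{q}\frac{1}{\prod_{i=1}^{n}(z-\gamma^{p_il})(z-\gamma^{-p_il})}$$ and $$F_q^{W+}(z:p_1,\dots,p_n,0)=\frac{F_q(z:p_1,\dots,p_n)}{(1-z)^W}.$$ Consequently, if $s_1,\dots,s_n$ are integers such that $F_q(z:p_1,\dots,p_n)=F_q(z:s_1,\dots,s_n)$ for $|z|<1$, then $F_q^{W+}(z:p_1,\dots,p_n,0)=F_q^{W+}(z:s_1,\dots,s_n,0)$ for $|z|<1$. -/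

import Mathlib

noncomputable section

namespace LensSpectrum

/-- The unit sphere of the Euclidean space with coordinates indexed by `σ`; it has dimension
`card σ - 1`. -/
abbrev Sph (σ : Type) [Fintype σ] : Type := Metric.sphere (0 : EuclideanSpace ℝ σ) 1

section Harmonics

variable (σ : Type) [Fintype σ] [DecidableEq σ]

/-- The flat Laplacian `∑ i, ∂² / ∂ x_i²` on complex valued polynomials on `ℝ^σ` (its sign plays
no role: only its kernel is used). -/
def flatLaplacian : MvPolynomial σ ℂ →ₗ[ℂ] MvPolynomial σ ℂ :=
  ∑ i : σ, (MvPolynomial.pderiv i).toLinearMap ∘ₗ (MvPolynomial.pderiv i).toLinearMap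

/-- `H^k`: the complex valued homogeneous harmonic polynomials of degree `k` on `ℝ^σ`. -/
def harmonicPoly (k : ℕ) : Submodule ℂ (MvPolynomial σ ℂ) :=
  MvPolynomial.homogeneousSubmodule σ ℂ k ⊓ LinearMap.ker (flatLaplacian σ)

/-- `i^*`: restriction of a polynomial function on `ℝ^σ` to the unit sphere. -/
def restrictSph : MvPolynomial σ ℂ →ₗ[ℂ] (Sph σ → ℂ) where
  toFun P := fun x => MvPolynomial.eval (fun j => ((x : EuclideanSpace ℝ σ) j : ℂ)) P
  map_add' P Q := by ext x; simp
  map_smul' c P := by ext x; simp [MvPolynomial.smul_eval]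

/-- `𝓗^k = i^*(H^k)`: the spherical harmonics of degree `k`, as functions on the unit sphere. -/
def sphericalHarmonic (k : ℕ) : Submodule ℂ (Sph σ → ℂ) :=
  (harmonicPoly σ k).map (restrictSph σ)

end Harmonics

section Invariants

variable {σ : Type} [Fintype σ] [DecidableEq σ]

theorem norm_toEuclideanLin (A : Matrix.orthogonalGroup σ ℝ) (x : EuclideanSpace ℝ σ) :
    ‖Matrix.toEuclideanLin (A : Matrix σ σ ℝ) x‖ = ‖x‖ := by
  have hA : (A : Matrix σ σ ℝ).transpose * (A : Matrix σ σ ℝ) = 1 :=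
    (Matrix.mem_orthogonalGroup_iff' (A := (A : Matrix σ σ ℝ))).1 A.2
  have h : ‖Matrix.toEuclideanLin (A : Matrix σ σ ℝ) x‖ ^ 2 = ‖x‖ ^ 2 := by
    have key : ∀ v : EuclideanSpace ℝ σ, ‖v‖ ^ 2 = v.ofLp ⬝ᵥ v.ofLp := by
      intro v
      rw [EuclideanSpace.norm_sq_eq]
      simp [dotProduct, sq]
    rw [key, key, Matrix.toLpLin_apply, Matrix.dotProduct_mulVec, Matrix.vecMul_mulVec, hA,
      Matrix.vecMul_one]
  exact (sq_eq_sq₀ (norm_nonneg _) (norm_nonneg _)).1 h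

/-- The action of an orthogonal matrix on the unit sphere, `x ↦ A x`. -/
def rotateSph (A : Matrix.orthogonalGroup σ ℝ) (x : Sph σ) : Sph σ :=
  ⟨Matrix.toEuclideanLin (A : Matrix σ σ ℝ) x, by
    rw [mem_sphere_zero_iff_norm, norm_toEuclideanLin, norm_eq_of_mem_sphere x]⟩

/-- The functions on the sphere that are invariant under the group `G`, i.e. the functions
that are pulled back from the orbit space of `G`. -/
def invariantFun (G : Subgroup (Matrix.orthogonalGroup σ ℝ)) : Submodule ℂ (Sph σ → ℂ) where
  carrier := {f | ∀ A ∈ G, ∀ x, f (rotateSph A x) = f x}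
  zero_mem' := by intro A _ x; rfl
  add_mem' := by
    intro f g hf hg A hA x
    simp [hf A hA x, hg A hA x]
  smul_mem' := by
    intro c f hf A hA x
    simp [hf A hA x]

/-- `𝓗^k_G`: the `G`-invariant functions in `𝓗^k`. -/
def invariantHarmonic (G : Subgroup (Matrix.orthogonalGroup σ ℝ)) (k : ℕ) :
    Submodule ℂ (Sph σ → ℂ) :=
  sphericalHarmonic σ k ⊓ invariantFun G

/-- The space of spherical harmonics is finite dimensional, so that `Module.finrank` below is the
dimension. -/
instance finite_invariantHarmonic (G : Subgroup (Matrix.orthogonalGroup σ ℝ)) (k : ℕ) :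
    FiniteDimensional ℂ (invariantHarmonic G k) := by
  have h1 : FiniteDimensional ℂ (MvPolynomial.homogeneousSubmodule σ ℂ k) := by
    have : MvPolynomial.homogeneousSubmodule σ ℂ k ≤ MvPolynomial.restrictTotalDegree σ ℂ k := by
      intro P hP
      rw [MvPolynomial.mem_restrictTotalDegree]
      exact MvPolynomial.IsHomogeneous.totalDegree_le hP
    have h0 : Set.Finite {n : σ →₀ ℕ | (n.sum fun _ e => e) ≤ k} := by
      refine (Set.finite_Iic (Finsupp.equivFunOnFinite.symm fun _ : σ => k)).subset ?_
      intro n hn i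
      have hn' : n.sum (fun _ e => e) ≤ k := hn
      rw [Finsupp.sum_fintype _ _ (fun _ => rfl)] at hn'
      exact (Finset.single_le_sum (f := fun j => n j) (fun _ _ => Nat.zero_le _)
        (Finset.mem_univ i)).trans hn'
    have h2 : FiniteDimensional ℂ (MvPolynomial.restrictTotalDegree σ ℂ k) := by
      have : Finite {n : σ →₀ ℕ | (n.sum fun _ e => e) ≤ k} := h0
      exact Module.Finite.of_basis
        (MvPolynomial.basisRestrictSupport ℂ {n : σ →₀ ℕ | (n.sum fun _ e => e) ≤ k})
    exact Submodule.finiteDimensional_of_le this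
  have h3 : FiniteDimensional ℂ (harmonicPoly σ k) :=
    Submodule.finiteDimensional_of_le (inf_le_left : harmonicPoly σ k ≤ _)
  have h4 : FiniteDimensional ℂ (sphericalHarmonic σ k) := by
    unfold sphericalHarmonic
    infer_instance
  exact Submodule.finiteDimensional_of_le (inf_le_left : invariantHarmonic G k ≤ _)

/-- The `k`-th term `(dim 𝓗^k_G) z^k` of the spectral generating function of the quotient of the
unit sphere by `G`. -/
def genTerm (G : Subgroup (Matrix.orthogonalGroup σ ℝ)) (z : ℂ) (k : ℕ) : ℂ :=
  (Module.finrank ℂ (invariantHarmonic G k) : ℂ) * z ^ k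

/-- The spectral generating function `∑ k, (dim 𝓗^k_G) z^k` of the quotient of the unit sphere
by `G`. -/
def genFun (G : Subgroup (Matrix.orthogonalGroup σ ℝ)) (z : ℂ) : ℂ :=
  ∑' k : ℕ, genTerm G z k

end Invariants

section Lens

/-- The plane rotation `R(θ)` with rows `(cos 2πθ, sin 2πθ)` and `(-sin 2πθ, cos 2πθ)`. -/
def rot (θ : ℝ) : Matrix (Fin 2) (Fin 2) ℝ :=
  !![Real.cos (2 * Real.pi * θ), Real.sin (2 * Real.pi * θ);
    -Real.sin (2 * Real.pi * θ), Real.cos (2 * Real.pi * θ)]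

theorem rot_mul_transpose (θ : ℝ) : rot θ * (rot θ).transpose = 1 := by
  ext i j
  have h := Real.sin_sq_add_cos_sq (2 * Real.pi * θ)
  fin_cases i <;> fin_cases j <;> simp [rot, Matrix.mul_apply, Fin.sum_univ_two] <;> linarith

variable {n : ℕ} (q : ℕ) (p : Fin n → ℤ) (W : ℕ)

/-- The block diagonal matrix `diag(R(p_1/q), …, R(p_n/q))` on `ℝ^(2n)`; the coordinate `(a, i)`
is the `a`-th coordinate of the `i`-th plane. -/
def lensMatrix : Matrix (Fin 2 × Fin n) (Fin 2 × Fin n) ℝ :=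
  Matrix.blockDiagonal fun i => rot ((p i : ℝ) / (q : ℝ))

theorem lensMatrix_mul_transpose : lensMatrix q p * (lensMatrix q p).transpose = 1 := by
  unfold lensMatrix
  rw [Matrix.blockDiagonal_transpose, ← Matrix.blockDiagonal_mul]
  simp only [rot_mul_transpose]
  exact Matrix.blockDiagonal_one

/-- The generator `g = diag(R(p_1/q), …, R(p_n/q))` of the group of the lens space
`L(q : p_1, …, p_n)`. -/
def lensGen : Matrix.orthogonalGroup (Fin 2 × Fin n) ℝ :=
  ⟨lensMatrix q p, (Matrix.mem_orthogonalGroup_iff (A := lensMatrix q p)).2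
    (lensMatrix_mul_transpose q p)⟩

/-- The block diagonal matrix `diag(R(p_1/q), …, R(p_n/q), I_W)` on `ℝ^(2n+W)`. -/
def paddedMatrix : Matrix ((Fin 2 × Fin n) ⊕ Fin W) ((Fin 2 × Fin n) ⊕ Fin W) ℝ :=
  Matrix.fromBlocks (lensMatrix q p) 0 0 1

theorem paddedMatrix_mul_transpose :
    paddedMatrix q p W * (paddedMatrix q p W).transpose = 1 := by
  unfold paddedMatrix
  rw [Matrix.fromBlocks_transpose, Matrix.fromBlocks_multiply]
  simp [lensMatrix_mul_transpose]

/-- The generator `g̃ = diag(R(p_1/q), …, R(p_n/q), I_W)` of the group of the padded lens space. -/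
def paddedGen : Matrix.orthogonalGroup ((Fin 2 × Fin n) ⊕ Fin W) ℝ :=
  ⟨paddedMatrix q p W, (Matrix.mem_orthogonalGroup_iff (A := paddedMatrix q p W)).2
    (paddedMatrix_mul_transpose q p W)⟩

/-- The cyclic group `G = ⟨g⟩`; the lens space `L(q : p_1, …, p_n)` is `S^(2n-1) / G`. -/
def lensGroup : Subgroup (Matrix.orthogonalGroup (Fin 2 × Fin n) ℝ) :=
  Subgroup.zpowers (lensGen q p)

/-- The cyclic group `G̃ = ⟨g̃⟩`; the padded lens space is `S^(2n+W-1) / G̃`. -/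
def paddedGroup : Subgroup (Matrix.orthogonalGroup ((Fin 2 × Fin n) ⊕ Fin W) ℝ) :=
  Subgroup.zpowers (paddedGen q p W)

end Lens

end LensSpectrum

end

/-! In each rotation plane the complex coordinates `x ∓ iy` diagonalize the generator, with
eigenvalues `ω ^ (± p_i)`; on the padding coordinates the eigenvalue is `1`. In such coordinates
every monomial is an eigenvector, so the invariant polynomials of degree `k` are spanned by the
monomials whose weight is divisible by `q` (`mem_weightSpace_iff_linSubst`). The Laplacian becomes a
constant coefficient operator that pairs variables of opposite weight, hence maps invariants of
degree `k` to invariants of degree `k - 2`.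

This map is onto (`secondOrder_surjective`). The invariant harmonics of degree `k` therefore have
dimension `a_k - a_(k-2)`, where `a_k` counts the admissible monomials, and the spectral generating
function is `(1 - z^2) ∑ a_k z^k`. Averaging over the `q`-th roots of unity turns the last series
into Molien's sum of products of geometric series (`coeff_molienSeries`).

A padding coordinate has weight `0`, so it multiplies every summand by the same factor `1 / (1 -
z)`. This gives the quotient relation between the two generating functions, and the other claims
follow from it and the explicit formula. -/

set_option linter.unusedSectionVars false

noncomputable section

namespace LensSpectrum

open MvPolynomial

/-! ### Weight spaces and surjectivity of second order operators -/

section Polynomials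

variable {σ : Type} [Fintype σ] [DecidableEq σ]

/-- The homogeneous polynomials of degree `d` spanned by the monomials `x ^ m` whose weight
`∑ j, e j * m j` is divisible by `q`. -/
def weightSpace (q : ℕ) (e : σ → ℤ) (d : ℕ) : Submodule ℂ (MvPolynomial σ ℂ) :=
  restrictSupport ℂ {m | m.degree = d ∧ (q : ℤ) ∣ ∑ j, e j * m j}

theorem mem_weightSpace {q : ℕ} {e : σ → ℤ} {d : ℕ} {Q : MvPolynomial σ ℂ} :
    Q ∈ weightSpace q e d ↔
      ∀ m, coeff m Q ≠ 0 → m.degree = d ∧ (q : ℤ) ∣ ∑ j, e j * m j := by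
  simp [weightSpace, mem_restrictSupport_iff, Set.subset_def, mem_support_iff]

theorem weight_add_single (e : σ → ℤ) (m : σ →₀ ℕ) (i : σ) :
    ∑ j, e j * (((m + Finsupp.single i 1 : σ →₀ ℕ) j : ℕ) : ℤ) = (∑ j, e j * (m j : ℤ)) + e i := by
  simp only [Finsupp.add_apply, Nat.cast_add, mul_add, Finset.sum_add_distrib]
  congr 1
  rw [Finset.sum_eq_single i] <;> simp +contextual [eq_comm]

theorem coeff_pderiv_pderiv (i j : σ) (m : σ →₀ ℕ) (Q : MvPolynomial σ ℂ)
    (h : coeff m (pderiv i (pderiv j Q)) ≠ 0) :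
    coeff (m + Finsupp.single i 1 + Finsupp.single j 1) Q ≠ 0 := by
  intro h0
  simp [coeff_pderiv, h0] at h

theorem pderiv_pderiv_mem {q : ℕ} {e : σ → ℤ} {d : ℕ} {Q : MvPolynomial σ ℂ} {i j : σ}
    (hij : e i + e j = 0) (hQ : Q ∈ weightSpace q e (d + 2)) :
    pderiv i (pderiv j Q) ∈ weightSpace q e d := by
  rw [mem_weightSpace] at hQ ⊢
  intro m hm
  obtain ⟨h1, h2⟩ := hQ _ (coeff_pderiv_pderiv i j m Q hm)
  rw [weight_add_single, weight_add_single, add_assoc, hij, add_zero] at h2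
  refine ⟨?_, h2⟩
  simp only [map_add, Finsupp.degree_single] at h1
  omega

theorem pderiv_pderiv_eq_zero {q : ℕ} {e : σ → ℤ} {d : ℕ} (hd : d < 2) {Q : MvPolynomial σ ℂ}
    (i j : σ) (hQ : Q ∈ weightSpace q e d) : pderiv i (pderiv j Q) = 0 := by
  ext m
  by_contra hm
  obtain ⟨h1, -⟩ := mem_weightSpace.1 hQ _ (coeff_pderiv_pderiv i j m Q hm)
  simp only [map_add, Finsupp.degree_single] at h1
  omega

/-- The second order operator `∑ i j, B i j ∂_i ∂_j` with constant coefficients. -/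
def secondOrder (B : Matrix σ σ ℂ) : MvPolynomial σ ℂ →ₗ[ℂ] MvPolynomial σ ℂ :=
  ∑ i, ∑ j, B i j • ((pderiv i).toLinearMap ∘ₗ (pderiv j).toLinearMap)

theorem secondOrder_apply (B : Matrix σ σ ℂ) (Q : MvPolynomial σ ℂ) :
    secondOrder B Q = ∑ i, ∑ j, B i j • pderiv i (pderiv j Q) := by
  simp [secondOrder, LinearMap.sum_apply]

/-- `∂_i ∂_j` lowers the weight by `e i + e j`, which vanishes whenever `B i j` does not. For the
Laplacian in diagonalizing coordinates this expresses its invariance under the group. -/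
theorem secondOrder_mem {q : ℕ} {e : σ → ℤ} {B : Matrix σ σ ℂ}
    (hB : ∀ i j, B i j ≠ 0 → e i + e j = 0) {d : ℕ} {Q : MvPolynomial σ ℂ}
    (hQ : Q ∈ weightSpace q e (d + 2)) : secondOrder B Q ∈ weightSpace q e d := by
  rw [secondOrder_apply]
  refine Submodule.sum_mem _ fun i _ => Submodule.sum_mem _ fun j _ => ?_
  by_cases h : B i j = 0
  · simp [h]
  · exact Submodule.smul_mem _ _ (pderiv_pderiv_mem (hB i j h) hQ)

theorem secondOrder_eq_zero {q : ℕ} {e : σ → ℤ} (B : Matrix σ σ ℂ) {d : ℕ} (hd : d < 2)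
    {Q : MvPolynomial σ ℂ} (hQ : Q ∈ weightSpace q e d) : secondOrder B Q = 0 := by
  simp [secondOrder_apply, pderiv_pderiv_eq_zero hd _ _ hQ]

/-- A right inverse of `∂_a ∂_b` for `a ≠ b`, given by integrating each monomial. -/
def integratePair (a b : σ) : MvPolynomial σ ℂ →ₗ[ℂ] MvPolynomial σ ℂ :=
  (basisMonomials σ ℂ).constr ℂ fun m =>
    monomial (m + Finsupp.single a 1 + Finsupp.single b 1) (1 / ((m a + 1 : ℂ) * (m b + 1)))

theorem integratePair_monomial (a b : σ) (m : σ →₀ ℕ) (r : ℂ) :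
    integratePair a b (monomial m r) =
      monomial (m + Finsupp.single a 1 + Finsupp.single b 1)
        (r * (1 / ((m a + 1 : ℂ) * (m b + 1)))) := by
  have h : monomial m r = r • basisMonomials σ ℂ m := by simp [smul_monomial]
  rw [h, map_smul, integratePair, Module.Basis.constr_basis, smul_monomial, smul_eq_mul]

theorem pderiv_pderiv_integratePair {a b : σ} (hab : a ≠ b) (Q : MvPolynomial σ ℂ) :
    pderiv a (pderiv b (integratePair a b Q)) = Q := by
  induction Q using MvPolynomial.induction_on' with
  | monomial m r =>
    have h1 : (m a + 1 : ℂ) ≠ 0 := Nat.cast_add_one_ne_zero _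
    have h2 : (m b + 1 : ℂ) ≠ 0 := Nat.cast_add_one_ne_zero _
    rw [integratePair_monomial, pderiv_monomial, pderiv_monomial]
    refine congrArg₂ (fun m r => monomial m r) ?_ ?_
    · simp
    · simp [hab]
      field_simp
  | add P Q hP hQ => simp [hP, hQ]

theorem pderiv_integratePair {a b j : σ} (ha : j ≠ a) (hb : j ≠ b) (Q : MvPolynomial σ ℂ) :
    pderiv j (integratePair a b Q) = integratePair a b (pderiv j Q) := by
  induction Q using MvPolynomial.induction_on' with
  | monomial m r =>
    rw [integratePair_monomial, pderiv_monomial, pderiv_monomial, integratePair_monomial]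
    by_cases hm : m j = 0
    · simp [hm, ha.symm, hb.symm]
    · refine congrArg₂ (fun m r => monomial m r) ?_ ?_
      · ext k
        by_cases hk : k = j
        · subst hk
          simp [ha.symm, hb.symm]
        · simp [Finsupp.single_apply, Ne.symm hk]
      · simp [ha, hb, ha.symm, hb.symm]
        ring
  | add P Q hP hQ => simp [hP, hQ]

theorem integratePair_mem {q : ℕ} {e : σ → ℤ} {d : ℕ} {a b : σ} (hab : e a + e b = 0)
    {Q : MvPolynomial σ ℂ} (hQ : Q ∈ weightSpace q e d) :
    integratePair a b Q ∈ weightSpace q e (d + 2) := by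
  have h : weightSpace q e d ≤ (weightSpace q e (d + 2)).comap (integratePair a b) := by
    rw [weightSpace, restrictSupport_eq_span, Submodule.span_le]
    rintro _ ⟨m, ⟨hm1, hm2⟩, rfl⟩
    simp only [SetLike.mem_coe, Submodule.mem_comap, integratePair_monomial]
    rw [weightSpace, monomial_mem_restrictSupport]
    left
    refine ⟨by simp [hm1], ?_⟩
    rwa [weight_add_single, weight_add_single, add_assoc, hab, add_zero]
  exact h hQ

theorem secondOrder_integratePair {a b : σ} {B : Matrix σ σ ℂ}
    (ha : ∀ j, B a j = 0) (ha' : ∀ j, B j a = 0) (hb : ∀ j, B b j = 0) (hb' : ∀ j, B j b = 0)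
    (Q : MvPolynomial σ ℂ) :
    secondOrder B (integratePair a b Q) = integratePair a b (secondOrder B Q) := by
  simp only [secondOrder_apply, map_sum, map_smul]
  refine Finset.sum_congr rfl fun i _ => Finset.sum_congr rfl fun j _ => ?_
  by_cases h : B i j = 0
  · simp [h]
  · have hia : i ≠ a := fun h' => h (h' ▸ ha j)
    have hib : i ≠ b := fun h' => h (h' ▸ hb j)
    have hja : j ≠ a := fun h' => h (h' ▸ ha' i)
    have hjb : j ≠ b := fun h' => h (h' ▸ hb' i)
    rw [pderiv_integratePair hja hjb, pderiv_integratePair hia hib]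

theorem pderiv_comm' (i j : σ) (Q : MvPolynomial σ ℂ) :
    pderiv i (pderiv j Q) = pderiv j (pderiv i Q) := by
  ext m
  by_cases h : i = j
  · rw [h]
  · simp only [coeff_pderiv, add_right_comm m (Finsupp.single i 1), Finsupp.add_apply,
      Finsupp.single_apply, h, Ne.symm h, if_false, add_zero]
    ring

/-- `∑ i j, B i j ∂_i ∂_j` is onto if it is the sum of a nonzero multiple of `∂_a ∂_b` and of an
operator in the other variables. -/
theorem secondOrder_surjective {q : ℕ} {e : σ → ℤ} {B : Matrix σ σ ℂ} {a b : σ} (hab : a ≠ b)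
    (hB : ∀ i j, B i j ≠ 0 → e i + e j = 0)
    (ha : ∀ j, j ≠ b → B a j = 0) (ha' : ∀ j, j ≠ b → B j a = 0)
    (hb : ∀ j, j ≠ a → B b j = 0) (hb' : ∀ j, j ≠ a → B j b = 0)
    (hc : B a b + B b a ≠ 0) (heab : e a + e b = 0) {d : ℕ} {f : MvPolynomial σ ℂ}
    (hf : f ∈ weightSpace q e d) :
    ∃ u ∈ weightSpace q e (d + 2), secondOrder B u = f := by
  -- `B'` is the part of `B` free of the variables `a` and `b`; it commutes with integration in
  -- these two variables.
  set B' : Matrix σ σ ℂ := fun i j => if i = a ∨ i = b ∨ j = a ∨ j = b then 0 else B i j with hB'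
  have hdecomp : ∀ Q, secondOrder B Q =
      (B a b + B b a) • pderiv a (pderiv b Q) + secondOrder B' Q := by
    intro Q
    have h1 : ∀ i j, B i j • pderiv i (pderiv j Q) =
        ((if i = a ∧ j = b then B a b • pderiv a (pderiv b Q) else 0) +
        (if i = b ∧ j = a then B b a • pderiv a (pderiv b Q) else 0)) +
        B' i j • pderiv i (pderiv j Q) := by
      intro i j
      by_cases h1 : i = a ∧ j = b
      · obtain ⟨rfl, rfl⟩ := h1
        simp [hB', hab]
      by_cases h2 : i = b ∧ j = a
      · obtain ⟨rfl, rfl⟩ := h2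
        simp [hB', hab, pderiv_comm' i j]
      rw [if_neg h1, if_neg h2]
      by_cases h3 : i = a ∨ i = b ∨ j = a ∨ j = b
      · have : B i j = 0 := by
          rcases h3 with rfl | rfl | rfl | rfl
          · exact ha _ fun h => h1 ⟨rfl, h⟩
          · exact hb _ fun h => h2 ⟨rfl, h⟩
          · exact ha' _ fun h => h2 ⟨h, rfl⟩
          · exact hb' _ fun h => h1 ⟨h, rfl⟩
        simp [hB', h3, this]
      · simp [hB', h3]
    rw [secondOrder_apply, secondOrder_apply]
    have h2 : ∀ (i' j' : σ) (x : MvPolynomial σ ℂ),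
        ∑ i, ∑ j, (if i = i' ∧ j = j' then x else 0) = x := by
      intro i' j' x
      rw [Finset.sum_eq_single i' (fun i _ hi => by simp [hi]) (by simp),
        Finset.sum_eq_single j' (fun j _ hj => by simp [hj]) (by simp)]
      simp
    rw [Finset.sum_congr rfl fun i _ => Finset.sum_congr rfl fun j _ => h1 i j]
    simp only [Finset.sum_add_distrib]
    rw [h2, h2, add_smul]
  have hB'e : ∀ i j, B' i j ≠ 0 → e i + e j = 0 := by
    intro i j h
    refine hB i j fun h0 => h ?_
    simp [hB', h0]
  have hcomm : ∀ Q, secondOrder B' (integratePair a b Q) =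
      integratePair a b (secondOrder B' Q) := fun Q =>
    secondOrder_integratePair (by simp [hB']) (by simp [hB']) (by simp [hB']) (by simp [hB']) Q
  -- With `S = integratePair a b`, `D' = secondOrder B'` and `c = B a b + B b a`, the operator is `c
  -- ∂_a ∂_b + D'`, and a solution for `f` is the Neumann series `∑ j, (-1)^j c^(-j-1) S^(j+1) D'^j
  -- f`. It terminates because `D'` lowers the degree by two. The power `S^r` is carried along so
  -- that induction on the degree applies to `D' f` with exponent `r + 1`.
  have hmain : ∀ (d r : ℕ) (f : MvPolynomial σ ℂ), f ∈ weightSpace q e d →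
      ∃ u ∈ weightSpace q e (d + 2 * r + 2), secondOrder B u = (integratePair a b ^ r) f := by
    intro d
    induction d using Nat.strong_induction_on with
    | _ d ih =>
      intro r f hf
      have hSmem : ∀ r, (integratePair a b ^ r) f ∈ weightSpace q e (d + 2 * r) := by
        intro r
        induction r with
        | zero => simpa using hf
        | succ r ihr =>
          rw [pow_succ', Module.End.mul_apply]
          exact integratePair_mem heab ihr
      have hScomm : ∀ r, secondOrder B' ((integratePair a b ^ r) f) =
          (integratePair a b ^ r) (secondOrder B' f) := by
        intro r
        induction r with
        | zero => simp
        | succ r ihr => rw [pow_succ', Module.End.mul_apply, hcomm, ihr, Module.End.mul_apply]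
      have hstep : secondOrder B ((integratePair a b ^ (r + 1)) f) =
          (B a b + B b a) • (integratePair a b ^ r) f +
            (integratePair a b ^ (r + 1)) (secondOrder B' f) := by
        rw [hdecomp, hScomm]
        congr 2
        rw [pow_succ', Module.End.mul_apply, pderiv_pderiv_integratePair hab]
      obtain ⟨u', hu', hu'eq⟩ : ∃ u' ∈ weightSpace q e (d + 2 * r + 2),
          secondOrder B u' = (integratePair a b ^ (r + 1)) (secondOrder B' f) := by
        by_cases hd : d < 2
        · exact ⟨0, Submodule.zero_mem _, by simp [secondOrder_eq_zero B' hd hf]⟩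
        · obtain ⟨d', rfl⟩ : ∃ d', d = d' + 2 := ⟨d - 2, by omega⟩
          obtain ⟨u, hu, hu2⟩ := ih d' (by omega) (r + 1) _ (secondOrder_mem hB'e hf)
          refine ⟨u, ?_, hu2⟩
          rwa [show d' + 2 + 2 * r + 2 = d' + 2 * (r + 1) + 2 by ring]
      -- By `hstep`, applying the operator to `S^(r+1) f` gives `c S^r f` plus an error `S^(r+1) D'
      -- f`; `u'` removes the error.
      refine ⟨(B a b + B b a)⁻¹ • ((integratePair a b ^ (r + 1)) f - u'),
        Submodule.smul_mem _ _ (Submodule.sub_mem _ (hSmem (r + 1)) hu'), ?_⟩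
      rw [map_smul, map_sub, hstep, hu'eq, add_sub_cancel_right, smul_smul, inv_mul_cancel₀ hc,
        one_smul]
  simpa using hmain d 0 f hf

end Polynomials

end LensSpectrum

namespace LensSpectrum

open MvPolynomial

/-! ### Dimension counts on weight spaces -/

section Dimension

variable {σ : Type} [Fintype σ] [DecidableEq σ]

theorem finite_degree_weight (q : ℕ) (e : σ → ℤ) (d : ℕ) :
    {m : σ →₀ ℕ | m.degree = d ∧ (q : ℤ) ∣ ∑ j, e j * m j}.Finite := by
  refine (Set.finite_Iic (Finsupp.equivFunOnFinite.symm fun _ : σ => d)).subset ?_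
  rintro m ⟨hm, -⟩ i
  rw [← hm]
  exact Finsupp.le_degree i m

instance finite_weightSpace (q : ℕ) (e : σ → ℤ) (d : ℕ) :
    FiniteDimensional ℂ (weightSpace q e d) :=
  have := (finite_degree_weight q e d).to_subtype
  Module.Finite.of_basis (basisRestrictSupport ℂ _)

theorem finrank_weightSpace (q : ℕ) (e : σ → ℤ) (d : ℕ) :
    Module.finrank ℂ (weightSpace q e d) =
      {m ∈ Finset.finsuppAntidiag (Finset.univ : Finset σ) d |
        (q : ℤ) ∣ ∑ j, e j * m j}.card := by
  have := (finite_degree_weight q e d).to_subtype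
  rw [weightSpace, Module.finrank_eq_nat_card_basis (basisRestrictSupport ℂ _),
    Nat.card_coe_set_eq, ← Set.ncard_coe_finset]
  congr 1
  ext m
  simp [Finset.mem_finsuppAntidiag, Finsupp.degree_eq_sum]

/-- Kernel of a constant coefficient operator on a weight space, when the operator is onto. -/
theorem finrank_inf_ker_add_two {q : ℕ} {e : σ → ℤ} {B : Matrix σ σ ℂ}
    (hB : ∀ i j, B i j ≠ 0 → e i + e j = 0) {d : ℕ}
    (hsurj : ∀ f ∈ weightSpace q e d, ∃ u ∈ weightSpace q e (d + 2), secondOrder B u = f) :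
    Module.finrank ℂ (weightSpace q e (d + 2) ⊓ LinearMap.ker (secondOrder B) :
        Submodule ℂ (MvPolynomial σ ℂ)) + Module.finrank ℂ (weightSpace q e d) =
      Module.finrank ℂ (weightSpace q e (d + 2)) := by
  set T := (secondOrder B).domRestrict (weightSpace q e (d + 2)) with hT
  have hr : LinearMap.range T = weightSpace q e d := by
    ext f
    constructor
    · rintro ⟨u, rfl⟩
      exact secondOrder_mem hB u.2
    · intro hf
      obtain ⟨u, hu, h⟩ := hsurj f hf
      exact ⟨⟨u, hu⟩, h⟩
  have hk : (LinearMap.ker T).map (weightSpace q e (d + 2)).subtype =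
      weightSpace q e (d + 2) ⊓ LinearMap.ker (secondOrder B) := by
    ext f
    simp only [Submodule.mem_map, LinearMap.mem_ker, Submodule.mem_inf]
    constructor
    · rintro ⟨u, hu, rfl⟩
      exact ⟨u.2, hu⟩
    · rintro ⟨h1, h2⟩
      exact ⟨⟨f, h1⟩, h2, rfl⟩
  have h := T.finrank_range_add_finrank_ker
  rw [hr] at h
  rw [← hk, (Submodule.equivMapOfInjective _ (Submodule.subtype_injective _) _).symm.finrank_eq, ← h, add_comm]

theorem inf_ker_of_lt_two {q : ℕ} {e : σ → ℤ} (B : Matrix σ σ ℂ) {d : ℕ} (hd : d < 2) :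
    weightSpace q e d ⊓ LinearMap.ker (secondOrder B) = weightSpace q e d :=
  inf_eq_left.2 fun _ hf => secondOrder_eq_zero B hd hf

end Dimension

/-! ### Linear changes of variables -/

section Substitution

variable {σ : Type} [Fintype σ] [DecidableEq σ]

/-- The algebra endomorphism `P ↦ P ∘ M` of the polynomial ring given by a matrix `M`. -/
def linSubst (M : Matrix σ σ ℂ) : MvPolynomial σ ℂ →ₐ[ℂ] MvPolynomial σ ℂ :=
  bind₁ M.toMvPolynomial

/-- Composing functions with linear maps is contravariant, hence the reversed order. -/
theorem linSubst_mul (M N : Matrix σ σ ℂ) (P : MvPolynomial σ ℂ) :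
    linSubst (M * N) P = linSubst N (linSubst M P) := by
  rw [linSubst, linSubst, linSubst, bind₁_bind₁]
  congr 2
  funext i
  exact Matrix.toMvPolynomial_mul M N i

theorem linSubst_one (P : MvPolynomial σ ℂ) : linSubst 1 P = P := by
  simp [linSubst]

theorem eval_linSubst (M : Matrix σ σ ℂ) (P : MvPolynomial σ ℂ) (x : σ → ℂ) :
    eval x (linSubst M P) = eval (M.mulVec x) P := by
  rw [linSubst, ← coe_aeval_eq_eval, ← coe_aeval_eq_eval]
  change aeval x (bind₁ _ P) = aeval _ P
  rw [aeval_bind₁]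
  congr 2
  funext i
  change eval x _ = _
  rw [Matrix.toMvPolynomial_eval_eq_apply]

theorem isHomogeneous_linSubst (M : Matrix σ σ ℂ) {P : MvPolynomial σ ℂ} {k : ℕ}
    (hP : P.IsHomogeneous k) : (linSubst M P).IsHomogeneous k := by
  rw [← one_mul k]
  exact hP.aeval M.toMvPolynomial fun i => Matrix.toMvPolynomial_isHomogeneous M i

theorem pderiv_linSubst (M : Matrix σ σ ℂ) (i : σ) (P : MvPolynomial σ ℂ) :
    pderiv i (linSubst M P) = ∑ j, M j i • linSubst M (pderiv j P) := by
  induction P using MvPolynomial.induction_on with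
  | C a => simp [linSubst]
  | add P Q hP hQ => simp [hP, hQ, Finset.sum_add_distrib]
  | mul_X P k hP =>
    have hX : pderiv i (linSubst M (X k)) = C (M k i) := by
      rw [linSubst, bind₁_X_right, Matrix.toMvPolynomial, map_sum, Finset.sum_eq_single i]
      · simp
      · intro b _ hb
        simp [hb]
      · simp
    simp only [map_mul, pderiv_mul, hP, hX, map_add, smul_add, Finset.sum_add_distrib,
      Finset.sum_mul]
    congr 1
    · exact Finset.sum_congr rfl fun j _ => by rw [smul_mul_assoc]
    · rw [Finset.sum_eq_single k]
      · simp [smul_eq_C_mul, mul_comm]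
      · intro b _ hb
        simp [hb.symm]
      · simp

/-- Two applications of the chain rule: the coefficient of `∂_a ∂_b` is `∑ i, M a i * M b i`, an
entry of `M * M.transpose`. -/
theorem flatLaplacian_linSubst (M : Matrix σ σ ℂ) (P : MvPolynomial σ ℂ) :
    flatLaplacian σ (linSubst M P) = linSubst M (secondOrder (M * M.transpose) P) := by
  have h : flatLaplacian σ (linSubst M P) = ∑ i, pderiv i (pderiv i (linSubst M P)) := by
    simp [flatLaplacian, LinearMap.sum_apply]
  rw [h, secondOrder_apply]
  have h1 : ∀ i, pderiv i (pderiv i (linSubst M P)) =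
      ∑ b, ∑ a, (M a i * M b i) • linSubst M (pderiv a (pderiv b P)) := by
    intro i
    rw [pderiv_linSubst, map_sum]
    refine Finset.sum_congr rfl fun b _ => ?_
    rw [Derivation.map_smul, pderiv_linSubst, Finset.smul_sum]
    exact Finset.sum_congr rfl fun a _ => by rw [smul_smul, mul_comm]
  simp only [h1, map_sum, map_smul, Matrix.mul_apply, Matrix.transpose_apply, Finset.sum_smul]
  rw [Finset.sum_comm]
  refine Eq.trans ?_ Finset.sum_comm
  exact Finset.sum_congr rfl fun b _ => Finset.sum_comm

theorem coeff_linSubst_diagonal (c : σ → ℂ) (P : MvPolynomial σ ℂ) (m : σ →₀ ℕ) :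
    coeff m (linSubst (Matrix.diagonal c) P) = (∏ j, c j ^ m j) * coeff m P := by
  induction P using MvPolynomial.induction_on' with
  | monomial n r =>
    have h : linSubst (Matrix.diagonal c) (monomial n r) = monomial n ((∏ j, c j ^ n j) * r) := by
      have hX : ∀ j, (Matrix.diagonal c).toMvPolynomial j = C (c j) * X j := by
        intro j
        rw [Matrix.toMvPolynomial, Finset.sum_eq_single j]
        · simp [C_mul_X_eq_monomial]
        · intro b _ hb
          simp [Matrix.diagonal_apply_ne' _ hb]
        · simp
      rw [linSubst, bind₁, aeval_monomial, monomial_eq, Finsupp.prod_fintype _ _ (by simp),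
        Finsupp.prod_fintype _ _ (by simp), algebraMap_eq]
      simp only [hX]
      simp only [mul_pow, Finset.prod_mul_distrib, map_mul, map_prod, map_pow]
      ring
    rw [h, coeff_monomial, coeff_monomial]
    split_ifs with h
    · rw [h]
    · simp
  | add P Q hP hQ => simp [hP, hQ, mul_add]

end Substitution

end LensSpectrum

namespace LensSpectrum

open MvPolynomial

/-! ### From invariant functions on the sphere to weight spaces -/

section Diagonalization

variable {σ : Type} [Fintype σ] [DecidableEq σ]

theorem eval_smul_of_isHomogeneous {P : MvPolynomial σ ℂ} {k : ℕ} (hP : P.IsHomogeneous k)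
    (c : ℂ) (x : σ → ℂ) : eval (c • x) P = c ^ k * eval x P := by
  have h : linSubst (Matrix.diagonal fun _ => c) P = c ^ k • P := by
    ext m
    rw [coeff_linSubst_diagonal, coeff_smul, smul_eq_mul]
    by_cases hm : coeff m P = 0
    · simp [hm]
    · rw [Finset.prod_pow_eq_pow_sum, ← Finsupp.degree_eq_sum]
      congr 2
      by_contra hne
      exact hm (hP.coeff_eq_zero hne)
  have h2 : (Matrix.diagonal fun _ => c).mulVec x = c • x := by
    ext i
    simp [Matrix.mulVec_diagonal]
  rw [← h2, ← eval_linSubst, h, smul_eval]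

/-- Homogeneity propagates the vanishing from the sphere to all nonzero real points, and these are
Zariski dense. With no variables the sphere is empty and the constant `1` would be a counterexample,
whence `Nonempty σ`. -/
theorem eq_zero_of_restrictSph_eq_zero [Nonempty σ] {P : MvPolynomial σ ℂ} {k : ℕ}
    (hP : P.IsHomogeneous k) (h : restrictSph σ P = 0) : P = 0 := by
  -- Positive coordinates already form a product of infinite sets, and they keep the point away from
  -- the origin, so that it can be normalized.
  refine funext_set (fun _ => ((↑) : ℝ → ℂ) '' Set.Ioi 0)
    (fun _ => (Set.Ioi_infinite 0).image Complex.ofReal_injective.injOn) fun x hx => ?_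
  choose y hy hyx using fun i => hx i (Set.mem_univ i)
  set v : EuclideanSpace ℝ σ := WithLp.toLp 2 y with hv
  have hv0 : v ≠ 0 := by
    intro h0
    have h1 := congrArg (fun w : EuclideanSpace ℝ σ => w (Classical.arbitrary σ)) h0
    exact (hy (Classical.arbitrary σ)).ne' h1
  have hn : ‖v‖ ≠ 0 := norm_ne_zero_iff.2 hv0
  let u : Sph σ := ⟨‖v‖⁻¹ • v, by simp [norm_smul, hn]⟩
  have hu : x = (‖v‖ : ℂ) • fun j => (((u : EuclideanSpace ℝ σ) j : ℝ) : ℂ) := by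
    funext j
    rw [← hyx j]
    have : (u : EuclideanSpace ℝ σ) j = ‖v‖⁻¹ * y j := rfl
    rw [Pi.smul_apply, this, smul_eq_mul, ← Complex.ofReal_mul, mul_inv_cancel_left₀ hn]
  rw [hu, eval_smul_of_isHomogeneous hP, map_zero]
  have := congrFun h u
  change eval _ P = 0 at this
  rw [this, mul_zero]

theorem rotateSph_one (x : Sph σ) : rotateSph 1 x = x := by
  ext j
  simp [rotateSph]

theorem rotateSph_mul (A B : Matrix.orthogonalGroup σ ℝ) (x : Sph σ) :
    rotateSph (A * B) x = rotateSph A (rotateSph B x) := by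
  ext j
  simp [rotateSph, Matrix.toLpLin_apply, Matrix.mulVec_mulVec]

theorem mem_invariantFun_zpowers {A : Matrix.orthogonalGroup σ ℝ} {f : Sph σ → ℂ} :
    f ∈ invariantFun (Subgroup.zpowers A) ↔ ∀ x, f (rotateSph A x) = f x := by
  refine ⟨fun h => h A (Subgroup.mem_zpowers A), fun h B hB => ?_⟩
  rw [Subgroup.zpowers_eq_closure] at hB
  induction hB using Subgroup.closure_induction with
  | mem B hB => rwa [Set.mem_singleton_iff.1 hB]
  | one => intro x; rw [rotateSph_one]
  | mul B C _ _ hB hC => intro x; rw [rotateSph_mul, hB, hC]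
  | inv B _ hB => intro x; rw [← hB, ← rotateSph_mul, mul_inv_cancel, rotateSph_one]

/-- The complexification of an orthogonal matrix. -/
def toComplex (A : Matrix.orthogonalGroup σ ℝ) : Matrix σ σ ℂ :=
  (A : Matrix σ σ ℝ).map (algebraMap ℝ ℂ)

theorem restrictSph_rotateSph (A : Matrix.orthogonalGroup σ ℝ) (P : MvPolynomial σ ℂ)
    (x : Sph σ) : restrictSph σ P (rotateSph A x) = restrictSph σ (linSubst (toComplex A) P) x := by
  change eval _ P = eval _ (linSubst _ P)
  rw [eval_linSubst]
  congr 2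
  funext i
  simp [rotateSph, Matrix.toLpLin_apply, Matrix.mulVec, dotProduct, toComplex]

theorem restrictSph_mem_invariantFun_iff [Nonempty σ] {A : Matrix.orthogonalGroup σ ℝ}
    {P : MvPolynomial σ ℂ} {k : ℕ} (hP : P.IsHomogeneous k) :
    restrictSph σ P ∈ invariantFun (Subgroup.zpowers A) ↔ linSubst (toComplex A) P = P := by
  rw [mem_invariantFun_zpowers]
  simp only [restrictSph_rotateSph]
  constructor
  · intro h
    rw [← sub_eq_zero]
    refine eq_zero_of_restrictSph_eq_zero ((isHomogeneous_linSubst _ hP).sub hP) ?_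
    rw [map_sub, sub_eq_zero]
    exact funext h
  · intro h x
    rw [h]

/-- The monomial `x ^ m` is an eigenvector with eigenvalue `ω ^ (∑ j, e j * m j)`, which is `1`
exactly when `q` divides the exponent. -/
theorem mem_weightSpace_iff_linSubst {q : ℕ} {ω : ℂ} (hω : IsPrimitiveRoot ω q) (hω0 : ω ≠ 0)
    (e : σ → ℤ) {k : ℕ} {Q : MvPolynomial σ ℂ} :
    Q ∈ weightSpace q e k ↔
      Q.IsHomogeneous k ∧ linSubst (Matrix.diagonal fun j => ω ^ e j) Q = Q := by
  have hprod : ∀ m : σ →₀ ℕ, ∏ j, (ω ^ e j) ^ m j = ω ^ (∑ j, e j * (m j : ℤ)) := by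
    intro m
    simp only [← zpow_natCast, ← zpow_mul]
    have h (s : Finset σ) : ∏ j ∈ s, ω ^ (e j * (m j : ℤ)) = ω ^ (∑ j ∈ s, e j * (m j : ℤ)) := by
      induction s using Finset.induction_on with
      | empty => simp
      | insert a s ha ih => rw [Finset.prod_insert ha, Finset.sum_insert ha, zpow_add₀ hω0, ih]
    exact h _
  rw [mem_weightSpace]
  constructor
  · intro h
    refine ⟨fun m hm => ?_, ?_⟩
    · rw [← (h m hm).1, Finsupp.degree_eq_weight_one]
      rfl
    · ext m
      rw [coeff_linSubst_diagonal]
      by_cases hm : coeff m Q = 0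
      · simp [hm]
      · rw [hprod, (hω.zpow_eq_one_iff_dvd _).2 (h m hm).2, one_mul]
  · rintro ⟨h1, h2⟩ m hm
    refine ⟨by_contra fun hne => hm (h1.coeff_eq_zero hne), ?_⟩
    have h3 := congrArg (coeff m) h2
    rw [coeff_linSubst_diagonal, hprod, mul_eq_right₀ hm] at h3
    exact (hω.zpow_eq_one_iff_dvd _).1 h3

/-- Passing to coordinates in which the generator of the group is diagonal. -/
theorem finrank_invariantHarmonic_zpowers [Nonempty σ] {A : Matrix.orthogonalGroup σ ℝ}
    {L L' : Matrix σ σ ℂ} (hL : L * L' = 1) {q : ℕ} {ω : ℂ} (hω : IsPrimitiveRoot ω q)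
    (hω0 : ω ≠ 0) {e : σ → ℤ}
    (hA : L * toComplex A = Matrix.diagonal (fun j => ω ^ e j) * L) (k : ℕ) :
    Module.finrank ℂ (invariantHarmonic (Subgroup.zpowers A) k) =
      Module.finrank ℂ (weightSpace q e k ⊓ LinearMap.ker (secondOrder (L * L.transpose)) :
        Submodule ℂ (MvPolynomial σ ℂ)) := by
  have hL' : L' * L = 1 := mul_eq_one_comm.1 hL
  have hleft : ∀ P, linSubst L' (linSubst L P) = P := fun P => by
    rw [← linSubst_mul, hL, linSubst_one]
  have hright : ∀ P, linSubst L (linSubst L' P) = P := fun P => by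
    rw [← linSubst_mul, hL', linSubst_one]
  have hLA : ∀ Q, linSubst (toComplex A) (linSubst L Q) = linSubst L Q ↔
      linSubst (Matrix.diagonal fun j => ω ^ e j) Q = Q := by
    intro Q
    rw [← linSubst_mul, hA, linSubst_mul]
    exact (Function.LeftInverse.injective hleft).eq_iff
  have hlap : ∀ Q, flatLaplacian σ (linSubst L Q) = 0 ↔ secondOrder (L * L.transpose) Q = 0 := by
    intro Q
    rw [flatLaplacian_linSubst, ← map_zero (linSubst L)]
    exact (Function.LeftInverse.injective hleft).eq_iff
  set K := weightSpace q e k ⊓ LinearMap.ker (secondOrder (L * L.transpose)) with hK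
  have hKmem : ∀ Q, Q ∈ K ↔ Q.IsHomogeneous k ∧ flatLaplacian σ (linSubst L Q) = 0 ∧
      linSubst (toComplex A) (linSubst L Q) = linSubst L Q := by
    intro Q
    rw [hK, Submodule.mem_inf, mem_weightSpace_iff_linSubst hω hω0, LinearMap.mem_ker, hLA, hlap]
    tauto
  -- Substituting `L` and then restricting to the sphere identifies `K` with the invariant
  -- harmonics. It is injective on `K` because `L` is invertible and restriction is injective on
  -- homogeneous polynomials.
  let T : MvPolynomial σ ℂ →ₗ[ℂ] (Sph σ → ℂ) := restrictSph σ ∘ₗ (linSubst L).toLinearMap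
  have hmap : K.map T = invariantHarmonic (Subgroup.zpowers A) k := by
    ext f
    constructor
    · rintro ⟨Q, hQ, rfl⟩
      obtain ⟨h1, h2, h3⟩ := (hKmem Q).1 hQ
      have h4 := isHomogeneous_linSubst L h1
      exact ⟨⟨linSubst L Q, ⟨h4, h2⟩, rfl⟩, (restrictSph_mem_invariantFun_iff h4).2 h3⟩
    · rintro ⟨⟨P, ⟨h1, h2⟩, rfl⟩, h3⟩
      refine ⟨linSubst L' P, (hKmem _).2 ⟨isHomogeneous_linSubst L' h1, ?_, ?_⟩, ?_⟩
      · rw [hright]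
        exact h2
      · rw [hright]
        exact (restrictSph_mem_invariantFun_iff h1).1 h3
      · change restrictSph σ (linSubst L (linSubst L' P)) = _
        rw [hright]
  have hinj : Function.Injective (T.domRestrict K) := by
    rw [injective_iff_map_eq_zero]
    rintro ⟨Q, hQ⟩ h
    have h1 := eq_zero_of_restrictSph_eq_zero (isHomogeneous_linSubst L ((hKmem Q).1 hQ).1) h
    rw [← map_zero (linSubst L)] at h1
    exact Subtype.ext (Function.LeftInverse.injective hleft h1)
  rw [← hmap, ← LinearMap.range_domRestrict]
  exact (LinearEquiv.ofInjective _ hinj).finrank_eq.symm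

end Diagonalization

end LensSpectrum

namespace LensSpectrum

/-! ### Absolutely convergent power series and Molien's formula -/

section Series

/-- The power series `F` converges absolutely at `z`, with sum `v`. -/
def HasEval (F : PowerSeries ℂ) (z v : ℂ) : Prop :=
  Summable (fun k => ‖PowerSeries.coeff k F * z ^ k‖) ∧
    HasSum (fun k => PowerSeries.coeff k F * z ^ k) v

namespace HasEval

variable {F G : PowerSeries ℂ} {z v w : ℂ}

/-- The Cauchy product of absolutely convergent series; this is why `HasEval` records absolute
convergence. -/
theorem mul (hF : HasEval F z v) (hG : HasEval G z w) : HasEval (F * G) z (v * w) := by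
  have h : (fun k => PowerSeries.coeff k (F * G) * z ^ k) = fun k =>
      ∑ kl ∈ Finset.HasAntidiagonal.antidiagonal k, (PowerSeries.coeff kl.1 F * z ^ kl.1) *
        (PowerSeries.coeff kl.2 G * z ^ kl.2) := by
    funext k
    rw [PowerSeries.coeff_mul, Finset.sum_mul]
    refine Finset.sum_congr rfl fun kl hkl => ?_
    rw [← Finset.HasAntidiagonal.mem_antidiagonal.1 hkl, pow_add]
    ring
  have h1 := summable_norm_sum_mul_antidiagonal_of_summable_norm hF.1 hG.1
  refine ⟨h1.congr fun k => by rw [← congrFun h k], ?_⟩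
  rw [h, ← hF.2.tsum_eq, ← hG.2.tsum_eq,
    tsum_mul_tsum_eq_tsum_sum_antidiagonal_of_summable_norm hF.1 hG.1]
  exact h1.of_norm.hasSum

theorem sub (hF : HasEval F z v) (hG : HasEval G z w) : HasEval (F - G) z (v - w) := by
  have h : (fun k => PowerSeries.coeff k (F - G) * z ^ k) = fun k =>
      PowerSeries.coeff k F * z ^ k - PowerSeries.coeff k G * z ^ k := by
    funext k
    rw [map_sub, sub_mul]
  unfold HasEval
  rw [h]
  refine ⟨(hF.1.add hG.1).of_nonneg_of_le (fun _ => norm_nonneg _) fun k => ?_, hF.2.sub hG.2⟩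
  rw [congrFun h]
  exact norm_sub_le _ _

theorem add (hF : HasEval F z v) (hG : HasEval G z w) : HasEval (F + G) z (v + w) := by
  have h : (fun k => PowerSeries.coeff k (F + G) * z ^ k) = fun k =>
      PowerSeries.coeff k F * z ^ k + PowerSeries.coeff k G * z ^ k := by
    funext k
    rw [map_add, add_mul]
  unfold HasEval
  rw [h]
  refine ⟨(hF.1.add hG.1).of_nonneg_of_le (fun _ => norm_nonneg _) fun k => ?_, hF.2.add hG.2⟩
  rw [congrFun h]
  exact norm_add_le _ _

theorem monomial (d : ℕ) (c z : ℂ) : HasEval (PowerSeries.monomial d c) z (c * z ^ d) := by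
  have h : ∀ k, k ≠ d → PowerSeries.coeff k (PowerSeries.monomial d c) * z ^ k = 0 := by
    intro k hk
    rw [PowerSeries.coeff_monomial, if_neg hk, zero_mul]
  constructor
  · refine summable_of_ne_finset_zero (s := {d}) fun k hk => ?_
    rw [h k (by simpa using hk), norm_zero]
  · have := hasSum_single d h
    rwa [PowerSeries.coeff_monomial, if_pos rfl] at this

theorem one (z : ℂ) : HasEval 1 z 1 := by
  have := monomial 0 1 z
  rwa [pow_zero, mul_one, PowerSeries.monomial_zero_eq_C_apply, map_one] at this

theorem sum {ι : Type*} (s : Finset ι) {f : ι → PowerSeries ℂ} {g : ι → ℂ}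
    (h : ∀ i ∈ s, HasEval (f i) z (g i)) : HasEval (∑ i ∈ s, f i) z (∑ i ∈ s, g i) := by
  classical
  induction s using Finset.induction_on with
  | empty => simpa using monomial 0 0 z
  | insert a s ha ih =>
    rw [Finset.sum_insert ha, Finset.sum_insert ha]
    exact (h a (Finset.mem_insert_self a s)).add
      (ih fun i hi => h i (Finset.mem_insert_of_mem hi))

theorem prod {ι : Type*} (s : Finset ι) {f : ι → PowerSeries ℂ} {g : ι → ℂ}
    (h : ∀ i ∈ s, HasEval (f i) z (g i)) : HasEval (∏ i ∈ s, f i) z (∏ i ∈ s, g i) := by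
  classical
  induction s using Finset.induction_on with
  | empty => simpa using one z
  | insert a s ha ih =>
    rw [Finset.prod_insert ha, Finset.prod_insert ha]
    exact (h a (Finset.mem_insert_self a s)).mul
      (ih fun i hi => h i (Finset.mem_insert_of_mem hi))

theorem geometric {c : ℂ} (hc : ‖c * z‖ < 1) :
    HasEval (PowerSeries.mk fun k => c ^ k) z (1 - c * z)⁻¹ := by
  have h : (fun k => PowerSeries.coeff k (PowerSeries.mk fun k => c ^ k) * z ^ k) =
      fun k => (c * z) ^ k := by
    funext k
    rw [PowerSeries.coeff_mk, mul_pow]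
  unfold HasEval
  rw [h]
  refine ⟨?_, hasSum_geometric_of_norm_lt_one hc⟩
  simp only [congrFun h, norm_pow]
  exact summable_geometric_of_lt_one (norm_nonneg _) hc

end HasEval

/-- Orthogonality of characters of the cyclic group: a geometric sum with ratio `γ ^ N`, a `q`-th
root of unity. -/
theorem sum_Icc_zpow_mul {q : ℕ} {γ : ℂ} (hγ : IsPrimitiveRoot γ q) (N : ℤ) :
    ∑ l ∈ Finset.Icc 1 q, γ ^ (N * (l : ℤ)) = if (q : ℤ) ∣ N then (q : ℂ) else 0 := by
  have h : ∀ l : ℕ, γ ^ (N * (l : ℤ)) = (γ ^ N) ^ l := fun l => by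
    rw [zpow_mul, zpow_natCast]
  simp only [h]
  split_ifs with hN
  · rw [(hγ.zpow_eq_one_iff_dvd N).2 hN]
    simp
  · have h1 : γ ^ N ≠ 1 := fun h1 => hN ((hγ.zpow_eq_one_iff_dvd N).1 h1)
    have h2 : (γ ^ N) ^ q = 1 := by
      rw [← zpow_natCast, ← zpow_mul, mul_comm, zpow_mul, zpow_natCast, hγ.pow_eq_one, one_zpow]
    have h3 : ∑ l ∈ Finset.Icc 1 q, (γ ^ N) ^ l = γ ^ N * ∑ l ∈ Finset.range q, (γ ^ N) ^ l := by
      rw [Finset.mul_sum]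
      refine Finset.sum_nbij' (fun l => l - 1) (fun l => l + 1) ?_ ?_ ?_ ?_ ?_
      · intro l hl
        simp only [Finset.mem_Icc, Finset.mem_range] at hl ⊢
        omega
      · intro l hl
        simp only [Finset.mem_Icc, Finset.mem_range] at hl ⊢
        omega
      · intro l hl
        simp only [Finset.mem_Icc] at hl
        omega
      · intro l _
        omega
      · intro l hl
        simp only [Finset.mem_Icc] at hl
        rw [← pow_succ', Nat.sub_add_cancel hl.1]
    rw [h3, geom_sum_eq h1, h2]
    simp

variable {σ : Type} [Fintype σ] [DecidableEq σ]

/-- The generating function of the dimensions of the weight spaces, in Molien's form. -/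
def molienSeries (q : ℕ) (γ : ℂ) (e : σ → ℤ) : PowerSeries ℂ :=
  PowerSeries.monomial 0 (1 / (q : ℂ)) *
    ∑ l ∈ Finset.Icc 1 q, ∏ j, PowerSeries.mk fun k => (γ ^ (e j * (l : ℤ))) ^ k

/-- Expanding the product over `j` gives one term `γ ^ (l * weight)` per monomial of degree `k`, and
the average over `l` keeps the weights divisible by `q`. Only divisibility survives, so `γ` may be
any primitive root, not just the one occurring in the diagonalization. -/
theorem coeff_molienSeries {q : ℕ} (hq : 0 < q) {γ : ℂ} (hγ : IsPrimitiveRoot γ q)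
    (e : σ → ℤ) (k : ℕ) :
    PowerSeries.coeff k (molienSeries q γ e) = Module.finrank ℂ (weightSpace q e k) := by
  have hγ0 : γ ≠ 0 := hγ.ne_zero hq.ne'
  have hq0 : (q : ℂ) ≠ 0 := Nat.cast_ne_zero.2 hq.ne'
  have hprod : ∀ (l : ℕ) (m : σ →₀ ℕ), ∏ j, (γ ^ (e j * (l : ℤ))) ^ m j =
      γ ^ ((∑ j, e j * (m j : ℤ)) * (l : ℤ)) := by
    intro l m
    rw [Finset.sum_mul]
    have h (s : Finset σ) : ∏ j ∈ s, (γ ^ (e j * (l : ℤ))) ^ m j =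
        γ ^ (∑ j ∈ s, e j * (m j : ℤ) * (l : ℤ)) := by
      induction s using Finset.induction_on with
      | empty => simp
      | insert a s ha ih =>
        rw [Finset.prod_insert ha, Finset.sum_insert ha, zpow_add₀ hγ0, ih, ← zpow_natCast,
          ← zpow_mul, mul_right_comm]
    exact h _
  rw [molienSeries, PowerSeries.monomial_zero_eq_C_apply, PowerSeries.coeff_C_mul, map_sum]
  simp only [PowerSeries.coeff_prod, PowerSeries.coeff_mk, hprod]
  rw [Finset.sum_comm, finrank_weightSpace, Finset.card_filter]
  simp only [sum_Icc_zpow_mul hγ, Nat.cast_sum, Finset.mul_sum]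
  refine Finset.sum_congr rfl fun m _ => ?_
  split_ifs <;> simp [hq0]

theorem hasEval_molienSeries {q : ℕ} (hq : 0 < q) {γ : ℂ} (hγ : IsPrimitiveRoot γ q)
    (e : σ → ℤ) {z : ℂ} (hz : ‖z‖ < 1) :
    HasEval (molienSeries q γ e) z
      (1 / (q : ℂ) * ∑ l ∈ Finset.Icc 1 q, ∏ j, (1 - γ ^ (e j * (l : ℤ)) * z)⁻¹) := by
  have hnorm : ‖γ‖ = 1 := hγ.norm'_eq_one hq.ne'
  have h := HasEval.monomial 0 (1 / (q : ℂ)) z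
  rw [pow_zero, mul_one] at h
  refine h.mul (HasEval.sum _ fun l _ => HasEval.prod _ fun j _ => HasEval.geometric ?_)
  rwa [norm_mul, norm_zpow, hnorm, one_zpow, one_mul]

/-- Molien's formula for the spectral generating function of a cyclic group that is diagonal in
suitable coordinates. -/
theorem summable_genTerm_and_genFun_eq {A : Matrix.orthogonalGroup σ ℝ}
    {L L' : Matrix σ σ ℂ} (hL : L * L' = 1) {q : ℕ} (hq : 0 < q) {ω γ : ℂ}
    (hω : IsPrimitiveRoot ω q) (hγ : IsPrimitiveRoot γ q) {e : σ → ℤ}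
    (hA : L * toComplex A = Matrix.diagonal (fun j => ω ^ e j) * L)
    {a b : σ} (hab : a ≠ b) {B : Matrix σ σ ℂ} (hLB : L * L.transpose = B)
    (hB : ∀ i j, B i j ≠ 0 → e i + e j = 0)
    (ha : ∀ j, j ≠ b → B a j = 0) (ha' : ∀ j, j ≠ b → B j a = 0)
    (hb : ∀ j, j ≠ a → B b j = 0) (hb' : ∀ j, j ≠ a → B j b = 0)
    (hc : B a b + B b a ≠ 0) (heab : e a + e b = 0) {z : ℂ} (hz : ‖z‖ < 1) :
    Summable (genTerm (Subgroup.zpowers A) z) ∧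
      genFun (Subgroup.zpowers A) z = (1 - z ^ 2) *
        (1 / (q : ℂ) * ∑ l ∈ Finset.Icc 1 q, ∏ j, (1 - γ ^ (e j * (l : ℤ)) * z)⁻¹) := by
  have : Nonempty σ := ⟨a⟩
  have hdim := finrank_invariantHarmonic_zpowers hL hω (hω.ne_zero hq.ne') hA
  rw [hLB] at hdim
  have hone : HasEval (1 - PowerSeries.X ^ 2) z (1 - z ^ 2) := by
    have h := (HasEval.one z).sub (HasEval.monomial 2 1 z)
    rwa [one_mul, ← PowerSeries.X_pow_eq] at h
  have hmain := hone.mul (hasEval_molienSeries hq hγ e hz)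
  -- The factor `1 - X ^ 2` encodes the difference of dimensions in degrees `k` and `k - 2`. For `k
  -- < 2` there is nothing to subtract, since every polynomial of such degree is harmonic.
  have hcoeff : ∀ k, PowerSeries.coeff k ((1 - PowerSeries.X ^ 2 : PowerSeries ℂ) * molienSeries q γ e) =
      Module.finrank ℂ (invariantHarmonic (Subgroup.zpowers A) k) := by
    intro k
    rw [hdim, sub_mul, one_mul, map_sub, PowerSeries.coeff_X_pow_mul', coeff_molienSeries hq hγ]
    by_cases hk : k < 2
    · rw [if_neg (by omega), sub_zero, inf_ker_of_lt_two B hk]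
    · obtain ⟨d, rfl⟩ : ∃ d, k = d + 2 := ⟨k - 2, by omega⟩
      rw [if_pos (by omega), Nat.add_sub_cancel, coeff_molienSeries hq hγ, sub_eq_iff_eq_add,
        ← Nat.cast_add, finrank_inf_ker_add_two hB fun f hf =>
          secondOrder_surjective hab hB ha ha' hb hb' hc heab hf]
  have hterm : genTerm (Subgroup.zpowers A) z = fun k =>
      PowerSeries.coeff k ((1 - PowerSeries.X ^ 2 : PowerSeries ℂ) * molienSeries q γ e) * z ^ k := by
    funext k
    rw [genTerm, hcoeff]
  rw [genFun, hterm]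
  exact ⟨hmain.2.summable, hmain.2.tsum_eq⟩

end Series

end LensSpectrum

namespace LensSpectrum

/-! ### Complex coordinates for the lens and padded lens groups -/

section Coordinates

/-- The coordinates `x ∓ i y` on a plane. -/
def planeCoord : Matrix (Fin 2) (Fin 2) ℂ := !![1, -Complex.I; 1, Complex.I]

/-- The inverse of `planeCoord`. -/
def planeCoordInv : Matrix (Fin 2) (Fin 2) ℂ :=
  !![1 / 2, 1 / 2; Complex.I / 2, -Complex.I / 2]

theorem planeCoord_mul_inv : planeCoord * planeCoordInv = 1 := by
  ext i j
  have h := Complex.I_mul_I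
  fin_cases i <;> fin_cases j <;>
    simp [planeCoord, planeCoordInv, Matrix.mul_apply, Fin.sum_univ_two] <;>
    first | linear_combination (-1 / 2 : ℂ) * h | linear_combination (1 / 2 : ℂ) * h

/-- The coordinates `x ∓ iy` are isotropic, so only the mixed derivative remains: the Laplacian of
the plane is four times it. -/
theorem planeCoord_mul_transpose :
    planeCoord * planeCoord.transpose = !![0, 2; 2, 0] := by
  ext i j
  fin_cases i <;> fin_cases j <;>
    simp [planeCoord, Matrix.mul_apply, Fin.sum_univ_two] <;> norm_num

/-- The standard primitive `q`-th root of unity. -/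
abbrev stdRoot (q : ℕ) : ℂ := Complex.exp (2 * Real.pi * Complex.I / q)

theorem stdRoot_zpow (q : ℕ) (p : ℤ) :
    stdRoot q ^ p = Complex.cos (2 * Real.pi * (p / q)) +
      Complex.sin (2 * Real.pi * (p / q)) * Complex.I := by
  rw [stdRoot, ← Complex.exp_int_mul, ← Complex.exp_mul_I]
  congr 1
  ring

theorem stdRoot_zpow_neg (q : ℕ) (p : ℤ) :
    stdRoot q ^ (-p) = Complex.cos (2 * Real.pi * (p / q)) -
      Complex.sin (2 * Real.pi * (p / q)) * Complex.I := by
  rw [stdRoot_zpow]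
  push_cast
  rw [neg_div, mul_neg, Complex.cos_neg, Complex.sin_neg]
  ring

theorem planeCoord_mul_rot (q : ℕ) (p : ℤ) :
    planeCoord * (rot ((p : ℝ) / (q : ℝ))).map (algebraMap ℝ ℂ) =
      Matrix.diagonal ![stdRoot q ^ p, stdRoot q ^ (-p)] * planeCoord := by
  have h := Complex.I_mul_I
  rw [stdRoot_zpow, stdRoot_zpow_neg]
  ext i j
  fin_cases i <;> fin_cases j <;>
    simp [planeCoord, rot, Matrix.mul_apply, Fin.sum_univ_two]
  · ring
  · linear_combination (Complex.sin (2 * Real.pi * (p / q))) * h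
  · ring
  · linear_combination (Complex.sin (2 * Real.pi * (p / q))) * h

variable {n : ℕ} (q : ℕ) (p : Fin n → ℤ) (W : ℕ)

/-- The complex coordinates `x_i ∓ i y_i` on `ℝ^(2n)`. -/
def lensCoord (n : ℕ) : Matrix (Fin 2 × Fin n) (Fin 2 × Fin n) ℂ :=
  Matrix.blockDiagonal fun _ => planeCoord

/-- The inverse of `lensCoord`. -/
def lensCoordInv (n : ℕ) : Matrix (Fin 2 × Fin n) (Fin 2 × Fin n) ℂ :=
  Matrix.blockDiagonal fun _ => planeCoordInv

/-- The matrix of the flat Laplacian on `ℝ^(2n)` in the coordinates `x_i ∓ i y_i`. -/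
def lensForm (n : ℕ) : Matrix (Fin 2 × Fin n) (Fin 2 × Fin n) ℂ :=
  Matrix.blockDiagonal fun _ => !![0, 2; 2, 0]

/-- The exponents of the eigenvalues of the generator of the group of the lens space. -/
def lensWeight (j : Fin 2 × Fin n) : ℤ := ![p j.2, -p j.2] j.1

theorem lensCoord_mul_inv : lensCoord n * lensCoordInv n = 1 := by
  rw [lensCoord, lensCoordInv, ← Matrix.blockDiagonal_mul]
  simp only [planeCoord_mul_inv]
  exact Matrix.blockDiagonal_one

theorem lensCoord_mul_transpose : lensCoord n * (lensCoord n).transpose = lensForm n := by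
  rw [lensCoord, Matrix.blockDiagonal_transpose, ← Matrix.blockDiagonal_mul, lensForm]
  simp only [planeCoord_mul_transpose]

theorem lensCoord_mul_lensMatrix :
    lensCoord n * (lensMatrix q p).map (algebraMap ℝ ℂ) =
      Matrix.diagonal (fun j => stdRoot q ^ lensWeight p j) * lensCoord n := by
  have h : (Matrix.diagonal fun j => stdRoot q ^ lensWeight p j) =
      Matrix.blockDiagonal fun i => Matrix.diagonal ![stdRoot q ^ p i, stdRoot q ^ (-p i)] := by
    rw [Matrix.blockDiagonal_diagonal]
    congr 1
    funext ⟨a, i⟩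
    fin_cases a <;> simp [lensWeight]
  rw [h, lensCoord, lensMatrix, Matrix.blockDiagonal_map _ _ (map_zero _),
    ← Matrix.blockDiagonal_mul, ← Matrix.blockDiagonal_mul]
  simp only [planeCoord_mul_rot]

theorem lensForm_apply (a b : Fin 2) (i j : Fin n) :
    lensForm n (a, i) (b, j) = if i = j ∧ a ≠ b then 2 else 0 := by
  rw [lensForm, Matrix.blockDiagonal_apply]
  fin_cases a <;> fin_cases b <;> simp

theorem lensWeight_add_eq_zero {x y : Fin 2 × Fin n} (h : lensForm n x y ≠ 0) :
    lensWeight p x + lensWeight p y = 0 := by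
  obtain ⟨a, i⟩ := x
  obtain ⟨b, j⟩ := y
  rw [lensForm_apply] at h
  obtain ⟨rfl, hab⟩ : i = j ∧ a ≠ b := by
    by_contra h'
    exact h (if_neg h')
  fin_cases a <;> fin_cases b <;> simp_all [lensWeight]

theorem lensForm_eq_zero {a b : Fin 2} (hab : a ≠ b) {i : Fin n} {x : Fin 2 × Fin n}
    (hx : x ≠ (b, i)) : lensForm n (a, i) x = 0 ∧ lensForm n x (a, i) = 0 := by
  obtain ⟨c, j⟩ := x
  rw [lensForm_apply, lensForm_apply]
  have h : ¬(i = j ∧ a ≠ c) := by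
    rintro ⟨rfl, h⟩
    apply hx
    congr 1
    omega
  exact ⟨if_neg h, if_neg fun h' => h ⟨h'.1.symm, h'.2.symm⟩⟩

/-- The eigenvalues come in pairs `ζ, ζ⁻¹`, and `(1 - ζ z) (1 - ζ⁻¹ z) = (z - ζ) (z - ζ⁻¹)` because
their product is `1`. -/
theorem prod_lensWeight {γ : ℂ} (hγ : γ ≠ 0) (l : ℕ) (z : ℂ) :
    ∏ j, (1 - γ ^ (lensWeight p j * (l : ℤ)) * z)⁻¹ =
      1 / ∏ i, ((z - γ ^ (p i * (l : ℤ))) * (z - γ ^ (-(p i) * (l : ℤ)))) := by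
  rw [Fintype.prod_prod_type_right, one_div, ← Finset.prod_inv_distrib]
  refine Finset.prod_congr rfl fun i _ => ?_
  rw [Fin.prod_univ_two, ← mul_inv]
  congr 1
  have h : γ ^ (p i * (l : ℤ)) * γ ^ (-(p i) * (l : ℤ)) = 1 := by
    rw [← zpow_add₀ hγ, neg_mul, add_neg_cancel, zpow_zero]
  simp only [lensWeight, Matrix.cons_val_zero, Matrix.cons_val_one]
  linear_combination (z ^ 2 - 1) * h

theorem lens_genFun (hq : 0 < q) (hn : 0 < n) {γ : ℂ} (hγ : IsPrimitiveRoot γ q) {z : ℂ}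
    (hz : ‖z‖ < 1) :
    Summable (genTerm (lensGroup q p) z) ∧
      genFun (lensGroup q p) z = (1 - z ^ 2) * ((1 / (q : ℂ)) * ∑ l ∈ Finset.Icc 1 q,
        1 / ∏ i : Fin n, ((z - γ ^ (p i * (l : ℤ))) * (z - γ ^ (-(p i) * (l : ℤ))))) := by
  -- Surjectivity of the Laplacian needs one pair of conjugate coordinates; the first plane provides
  -- it.
  let i₀ : Fin n := ⟨0, hn⟩
  have h01 : (0 : Fin 2) ≠ 1 := by decide
  have h := summable_genTerm_and_genFun_eq (A := lensGen q p) lensCoord_mul_inv hq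
    (Complex.isPrimitiveRoot_exp q hq.ne') hγ (lensCoord_mul_lensMatrix q p)
    (a := (0, i₀)) (b := (1, i₀)) (by simp) lensCoord_mul_transpose
    (fun _ _ => lensWeight_add_eq_zero p)
    (fun _ hj => (lensForm_eq_zero h01 hj).1) (fun _ hj => (lensForm_eq_zero h01 hj).2)
    (fun _ hj => (lensForm_eq_zero h01.symm hj).1) (fun _ hj => (lensForm_eq_zero h01.symm hj).2)
    (by simp [lensForm_apply]) (by simp [lensWeight]) hz
  simp only [prod_lensWeight p (hγ.ne_zero hq.ne')] at h
  exact h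

/-- The padding coordinates are left real: they have weight `0` and enter the form through an
identity block, disjoint from the chosen conjugate pair. Each contributes `(1 - z)⁻¹` to every
summand, so `(1 - z)⁻¹ ^ W` factors out of the sum over `l`. -/
theorem padded_genFun (hq : 0 < q) (hn : 0 < n) {γ : ℂ} (hγ : IsPrimitiveRoot γ q) {z : ℂ}
    (hz : ‖z‖ < 1) :
    Summable (genTerm (paddedGroup q p W) z) ∧
      genFun (paddedGroup q p W) z = (1 - z ^ 2) * ((1 / (q : ℂ)) * ∑ l ∈ Finset.Icc 1 q,
        1 / ∏ i : Fin n, ((z - γ ^ (p i * (l : ℤ))) * (z - γ ^ (-(p i) * (l : ℤ))))) /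
          (1 - z) ^ W := by
  let i₀ : Fin n := ⟨0, hn⟩
  have h01 : (0 : Fin 2) ≠ 1 := by decide
  have hL : Matrix.fromBlocks (lensCoord n) 0 0 (1 : Matrix (Fin W) (Fin W) ℂ) *
      Matrix.fromBlocks (lensCoordInv n) 0 0 1 = 1 := by
    simp [Matrix.fromBlocks_multiply, lensCoord_mul_inv]
  have hA : Matrix.fromBlocks (lensCoord n) 0 0 (1 : Matrix (Fin W) (Fin W) ℂ) *
      toComplex (paddedGen q p W) =
      Matrix.diagonal (fun j => stdRoot q ^ (Sum.elim (lensWeight p) 0 j : ℤ)) *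
        Matrix.fromBlocks (lensCoord n) 0 0 1 := by
    have h1 : (Matrix.diagonal fun j => stdRoot q ^ (Sum.elim (lensWeight p) 0 j : ℤ)) =
        Matrix.fromBlocks (Matrix.diagonal fun j => stdRoot q ^ lensWeight p j) 0 0
          (1 : Matrix (Fin W) (Fin W) ℂ) := by
      rw [← Matrix.diagonal_one, Matrix.fromBlocks_diagonal]
      congr 1
      funext j
      cases j <;> simp
    have h2 : toComplex (paddedGen q p W) = Matrix.fromBlocks
        ((lensMatrix q p).map (algebraMap ℝ ℂ)) 0 0 (1 : Matrix (Fin W) (Fin W) ℂ) := by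
      change (Matrix.fromBlocks _ _ _ _).map _ = _
      rw [Matrix.fromBlocks_map]
      simp
    rw [h1, h2, Matrix.fromBlocks_multiply, Matrix.fromBlocks_multiply]
    rw [lensCoord_mul_lensMatrix]
    simp
  have hLB : Matrix.fromBlocks (lensCoord n) 0 0 (1 : Matrix (Fin W) (Fin W) ℂ) *
      (Matrix.fromBlocks (lensCoord n) 0 0 (1 : Matrix (Fin W) (Fin W) ℂ)).transpose =
      Matrix.fromBlocks (lensForm n) 0 0 1 := by
    simp [Matrix.fromBlocks_transpose, Matrix.fromBlocks_multiply, lensCoord_mul_transpose]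
  have hzero : ∀ {a b : Fin 2}, a ≠ b → ∀ j, j ≠ Sum.inl (b, i₀) →
      Matrix.fromBlocks (lensForm n) 0 0 (1 : Matrix (Fin W) (Fin W) ℂ) (Sum.inl (a, i₀)) j = 0 ∧
      Matrix.fromBlocks (lensForm n) 0 0 (1 : Matrix (Fin W) (Fin W) ℂ) j (Sum.inl (a, i₀)) = 0 := by
    rintro a b hab (j | j) hj
    · exact lensForm_eq_zero hab fun h => hj (congrArg _ h)
    · simp
  obtain ⟨h1, h2⟩ := summable_genTerm_and_genFun_eq (A := paddedGen q p W) hL hq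
    (Complex.isPrimitiveRoot_exp q hq.ne') hγ hA
    (a := Sum.inl (0, i₀)) (b := Sum.inl (1, i₀)) (by simp) hLB
    (by
      rintro (i | i) (j | j) h
      · exact lensWeight_add_eq_zero p h
      · simp at h
      · simp at h
      · simp)
    (fun _ hj => (hzero h01 _ hj).1) (fun _ hj => (hzero h01 _ hj).2)
    (fun _ hj => (hzero h01.symm _ hj).1) (fun _ hj => (hzero h01.symm _ hj).2)
    (by simp [lensForm_apply]) (by simp [lensWeight]) hz
  refine ⟨h1, h2.trans ?_⟩
  simp only [Fintype.prod_sum_type, Sum.elim_inl, Sum.elim_inr, Pi.zero_apply, zero_mul, zpow_zero,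
    one_mul, Finset.prod_const, Finset.card_univ, Fintype.card_fin,
    prod_lensWeight p (hγ.ne_zero hq.ne'), ← Finset.sum_mul, inv_pow]
  rw [div_eq_mul_inv]
  ring

end Coordinates

end LensSpectrum

end

/-! ### The main theorem -/

theorem theorem3p2p3 (q n W : ℕ) (hq : 0 < q) (hn : 0 < n) (p : Fin n → ℤ)
    (γ : ℂ) (hγ : IsPrimitiveRoot γ q) :
    (∀ z : ℂ, ‖z‖ < 1 →
      Summable (LensSpectrum.genTerm (LensSpectrum.paddedGroup q p W) z) ∧
      LensSpectrum.genFun (LensSpectrum.paddedGroup q p W) z =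
        (1 + z) / (1 - z) ^ ((W : ℤ) - 1) *
          ((1 / (q : ℂ)) * ∑ l ∈ Finset.Icc 1 q,
            1 / ∏ i : Fin n, ((z - γ ^ (p i * (l : ℤ))) * (z - γ ^ (-(p i) * (l : ℤ)))))) ∧
    (∀ z : ℂ, ‖z‖ < 1 →
      Summable (LensSpectrum.genTerm (LensSpectrum.lensGroup q p) z) ∧
      LensSpectrum.genFun (LensSpectrum.paddedGroup q p W) z =
        LensSpectrum.genFun (LensSpectrum.lensGroup q p) z / (1 - z) ^ W) ∧
    (∀ s : Fin n → ℤ,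
      (∀ z : ℂ, ‖z‖ < 1 → LensSpectrum.genFun (LensSpectrum.lensGroup q p) z =
        LensSpectrum.genFun (LensSpectrum.lensGroup q s) z) →
      ∀ z : ℂ, ‖z‖ < 1 → LensSpectrum.genFun (LensSpectrum.paddedGroup q p W) z =
        LensSpectrum.genFun (LensSpectrum.paddedGroup q s W) z) := by
  have key : ∀ (s : Fin n → ℤ) (z : ℂ), ‖z‖ < 1 →
      LensSpectrum.genFun (LensSpectrum.paddedGroup q s W) z =
        LensSpectrum.genFun (LensSpectrum.lensGroup q s) z / (1 - z) ^ W := fun s z hz => by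
    rw [(LensSpectrum.padded_genFun q s W hq hn hγ hz).2,
      (LensSpectrum.lens_genFun q s hq hn hγ hz).2]
  refine ⟨fun z hz => ?_, fun z hz => ⟨(LensSpectrum.lens_genFun q p hq hn hγ hz).1, key p z hz⟩,
    fun s hs z hz => by rw [key p z hz, key s z hz, hs z hz]⟩
  obtain ⟨h1, h2⟩ := LensSpectrum.padded_genFun q p W hq hn hγ hz
  refine ⟨h1, h2.trans ?_⟩
  -- The exponent `W - 1` is an integer, equal to `-1` when `W = 0`. As `1 - z` is invertible in the
  -- disc, one factor cancels in `1 - z^2 = (1 - z) (1 + z)`.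
  have hz1 : 1 - z ≠ 0 := by
    intro h
    rw [← sub_eq_zero.1 h, norm_one] at hz
    exact lt_irrefl _ hz
  rw [zpow_sub₀ hz1, zpow_one, zpow_natCast]
  field_simp
  ring
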